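/- Let $X$ be a uniformly convex real Banach space. A function $f\colon X\to\mathbb{R}$ is called a U-function if it is continuous, strictly convex (that is, $f(\frac{x+y}{2})<\frac12(f(x)+f(y))$ for all $x\neq y$ in $X$), bounded on bounded sets, and coercive (that is, $\{x\in X: f(x)\le C\}$ is bounded for every $C\in\mathbb{R}$). It has the small diameter property if for every $x\in X$ and every $x^*\in\partial f(x)=\{x^*\in X^*: f(x)+x^*(y-x)\le f(y)\ \forall y\in X\}$, each sequence $(x_n)$ in $X$ with $x^*(x_n)-f(x_n)\to x^*(x)-f(x)$ is norm convergent. Let $f_1,\dots,f_N\colon X\to\mathbb{R}$ be U-functions that are Gâteaux differentiable at every point of $X$ and have the small diameter property. Let $\Sigma_N=\{t\in[0,1]^N:\sum_{i=1}^N t_i=1\}$. Then for each $t\in\Sigma_N$ the function $u_t=\sum_{i=1}^N t_if_i$ has a unique minimum point $\mathrm{argmin}(u_t)$, and there is a sequence $(\varepsilon_n)_{n\ge1}$ of positive numbers with $\varepsilon_n\to0$, depending only on $X$ and $f_1,\dots,f_N$, such that the following holds. For every $t\in\Sigma_N$, every probability space $(\Omega,\mu)$ and every sequence $F_1,F_2,\dots$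 of independent random variables on $\Omega$ which take the values $f_1,\dots,f_N$ with probabilities $t_1,\dots,t_N$ (that is, each $F_k$ has the law $\sum_{i=1}^N t_i\delta_{f_i}$), and for every $n\ge1$, the function $\frac1n\sum_{k=1}^nF_k(\omega)$ has a unique minimum point for almost every $\omega$, the integrand below is integrable, and $$\int_\Omega\Big\|\mathrm{argmin}\Big(\frac1n\sum_{k=1}^nF_k(\omega)\Big)-\mathrm{argmin}(u_t)\Big\|\,d\mu(\omega)\le\varepsilon_n.$$ -/

import Mathlib

open Set Filter Topology MeasureTheory ProbabilityTheory
open scoped ENNReal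

section Functions

variable {X : Type*} [NormedAddCommGroup X] [NormedSpace ℝ X]

/-- A U-function: a continuous, strictly convex function which is bounded on bounded sets and
coercive. Strict convexity is stated for midpoints; for a continuous function this is the same as
`StrictConvexOn ℝ Set.univ f`. -/
structure IsUFunction (f : X → ℝ) : Prop where
  continuous : Continuous f
  strictConvex : ∀ x y : X, x ≠ y → f ((2⁻¹ : ℝ) • (x + y)) < 2⁻¹ * (f x + f y)
  bounded : ∀ B : Set X, Bornology.IsBounded B → Bornology.IsBounded (f '' B)
  coercive : ∀ C : ℝ, Bornology.IsBounded {x : X | f x ≤ C}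

/-- `f` is Gâteaux differentiable at `x`: all directional derivatives at `x` exist and they are
given by a continuous linear functional. -/
def GateauxDifferentiableAt (f : X → ℝ) (x : X) : Prop :=
  ∃ f' : StrongDual ℝ X, ∀ v : X, HasLineDerivAt ℝ f (f' v) x v

/-- The subdifferential of `f` at `x`. -/
def subdifferentialAt (f : X → ℝ) (x : X) : Set (StrongDual ℝ X) :=
  {φ | ∀ y : X, f x + φ (y - x) ≤ f y}

/-- `x` is a `φ`-small diameter point for `f` (used for `φ` in the subdifferential of `f` at `x`):
each sequence `u` with `φ (u n) - f (u n) → φ x - f x` is norm convergent. -/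
def IsSmallDiameterPointFor (f : X → ℝ) (φ : StrongDual ℝ X) (x : X) : Prop :=
  ∀ u : ℕ → X, Tendsto (fun n => φ (u n) - f (u n)) atTop (𝓝 (φ x - f x)) →
    ∃ y : X, Tendsto u atTop (𝓝 y)

/-- `x` is a small diameter point for `f`. -/
def IsSmallDiameterPoint (f : X → ℝ) (x : X) : Prop :=
  ∀ φ ∈ subdifferentialAt f x, IsSmallDiameterPointFor f φ x

/-- The small diameter property (SDP). -/
def HasSmallDiameterProperty (f : X → ℝ) : Prop :=
  ∀ x : X, IsSmallDiameterPoint f x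

/-- The minimum point of `g`, meaningful when `∃! x, IsMinOn g univ x`. -/
noncomputable def argmin (g : X → ℝ) : X :=
  Classical.epsilon fun x => IsMinOn g univ x

/-- The convex combination `u_t = ∑ i, t i • f i`. -/
def weightedSum {N : ℕ} (f : Fin N → X → ℝ) (t : Fin N → ℝ) : X → ℝ :=
  fun x => ∑ i, t i * f i x

/-- The empirical mean `(1/n) ∑_{k<n} F k ω`, a random function on `X`. -/
noncomputable def empiricalMean {Ω : Type*} (F : ℕ → Ω → X → ℝ) (n : ℕ) (ω : Ω) : X → ℝ :=
  fun x => (1 / (n : ℝ)) * ∑ k ∈ Finset.range n, F k ω x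

/-- `F 0, F 1, …` are independent random functions which take the value `f i` with probability
`t i`: each `F k` is measurable and has the law `∑ i, t i • δ_{f i}`. The target, of which only
finitely many points matter, carries the discrete σ-algebra. -/
structure IsRandomSample {N : ℕ} (f : Fin N → X → ℝ) (t : Fin N → ℝ)
    {Ω : Type*} [MeasurableSpace Ω] (μ : Measure Ω) (F : ℕ → Ω → X → ℝ) : Prop where
  measurable : ∀ k, Measurable[_, (⊤ : MeasurableSpace (X → ℝ))] (F k)
  law : ∀ k, @Measure.map Ω (X → ℝ) _ ⊤ (F k) μ =
    ∑ i, ENNReal.ofReal (t i) • @Measure.dirac (X → ℝ) ⊤ (f i)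
  indep : iIndepFun (m := fun _ : ℕ => (⊤ : MeasurableSpace (X → ℝ))) F μ

end Functions

/-!
For weights `t` in the simplex let `x_t` be the minimum point of `u_t = ∑ i, t i • f i`. The heart
of the matter is that `t ↦ x_t` is norm continuous on the simplex.

Existence of `x_t` comes from the fact that decreasing sequences of nonempty closed bounded convex
sets in a uniformly convex space have a common point
(`exists_mem_forall_of_antitone_midpoint_mem`), applied to sublevel sets. For continuity, coercivity
keeps all `x_s` in one ball, on which `u_s → u_t` uniformly as `s → t`; hence `u_t (x_s) → u_t (x_t)`
and it suffices that minimizing sequences of `u_t` converge. By Gâteaux differentiability the zero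
functional, which is a subgradient of `u_t` at `x_t`, splits as `∑ i, t i • φ i` with `φ i` a
subgradient of `f i`. The excess `u_t y - u_t x_t` is then a sum of the nonnegative excesses of the
`f i` over their supporting affine functions, so along a minimizing sequence the excess of any `f i`
with `t i ≠ 0` tends to zero and its small diameter property gives convergence
(`tendsto_of_tendsto_weightedSum`).

By compactness of the simplex, `‖x_s - x_t‖ ≤ δ + C_δ * ∑ i, (s i - t i) ^ 2` for each `δ > 0`
(`exists_forall_norm_argmin_sub_le`). The mean of `n` sampled functions is almost surely `u_s` with
`s` the vector of empirical frequencies, whose mean square deviation from `t` is at most `1 / n` in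
each coordinate (`integral_empiricalFrequency_sub_sq_le`). So the mean distance of the minimum
points is at most `δ + C_δ * N / n` for all `δ`, a bound which does not depend on `t` or on the
sample.
-/

/-! ### Existence of minimum points in uniformly convex spaces -/

/-- A decreasing sequence of nonempty closed bounded midpoint-convex sets in a uniformly convex
Banach space has a common point. This is the only consequence of reflexivity which is needed, and
it has a direct proof: almost-nearest points `x n ∈ C n` to the origin form a Cauchy sequence, since
midpoints of `x n` and `x m` cannot be much closer to the origin than these points are. -/
theorem exists_mem_forall_of_antitone_midpoint_mem {X : Type*} [NormedAddCommGroup X]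
    [NormedSpace ℝ X] [CompleteSpace X] [UniformConvexSpace X] {C : ℕ → Set X}
    (hanti : Antitone C) (hne : ∀ n, (C n).Nonempty) (hclosed : ∀ n, IsClosed (C n))
    (hbdd : Bornology.IsBounded (C 0))
    (hmid : ∀ n, ∀ x ∈ C n, ∀ y ∈ C n, (2⁻¹ : ℝ) • (x + y) ∈ C n) :
    ∃ x, ∀ n, x ∈ C n := by
  obtain ⟨R, hR⟩ := hbdd.exists_norm_le
  set d : ℕ → ℝ := fun n => Metric.infDist 0 (C n) with hd
  have hd_le : ∀ n, ∀ x ∈ C n, d n ≤ ‖x‖ := fun n x hx => by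
    simpa using Metric.infDist_le_dist_of_mem (x := (0 : X)) hx
  have hd_mono : Monotone d := fun m n hmn => Metric.infDist_le_infDist_of_subset (hanti hmn) (hne n)
  have hd_bdd : BddAbove (range d) := by
    refine ⟨R, ?_⟩
    rintro _ ⟨n, rfl⟩
    obtain ⟨x, hx⟩ := hne n
    exact (hd_le n x hx).trans (hR x (hanti (Nat.zero_le n) hx))
  set D : ℝ := ⨆ n, d n with hD
  have hd_lim : Tendsto d atTop (𝓝 D) := tendsto_atTop_ciSup hd_mono hd_bdd
  have hdD : ∀ n, d n ≤ D := le_ciSup hd_bdd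
  have hD0 : 0 ≤ D := Metric.infDist_nonneg.trans (hdD 0)
  have hη : ∀ n : ℕ, (0 : ℝ) < 1 / ((n : ℝ) + 1) := fun n => Nat.one_div_pos_of_nat
  have hx : ∀ n : ℕ, ∃ x ∈ C n, ‖x‖ < d n + 1 / ((n : ℝ) + 1) := fun n => by
    obtain ⟨x, hx, hlt⟩ := (Metric.infDist_lt_iff (hne n)).1
      (lt_add_of_pos_right (Metric.infDist 0 (C n)) (hη n))
    exact ⟨x, hx, by simpa using hlt⟩
  choose x hxC hxlt using hx
  -- Points of norm slightly above `D` are shrunk into the ball of radius `D`, because the modulus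
  -- of convexity is only available for a fixed radius.
  have hshrink : ∀ (η : ℝ), 0 < η → ∀ z : X, ‖z‖ ≤ D + η → ∃ z' : X, ‖z'‖ ≤ D ∧ ‖z - z'‖ ≤ η := by
    intro η hη z hz
    have hpos : 0 < D + η := by linarith
    refine ⟨(D / (D + η)) • z, ?_, ?_⟩
    · rw [norm_smul, Real.norm_of_nonneg (by positivity), div_mul_eq_mul_div, div_le_iff₀ hpos]
      exact mul_le_mul_of_nonneg_left hz hD0
    · have : z - (D / (D + η)) • z = (η / (D + η)) • z := by
        rw [sub_eq_iff_eq_add, ← add_smul, ← add_div, add_comm η, div_self hpos.ne', one_smul]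
      rw [this, norm_smul, Real.norm_of_nonneg (by positivity), div_mul_eq_mul_div,
        div_le_iff₀ hpos]
      exact mul_le_mul_of_nonneg_left hz hη.le
  have hcauchy : CauchySeq x := by
    refine Metric.cauchySeq_iff'.2 fun ε hε => ?_
    obtain ⟨δ, hδ, hconv⟩ := exists_forall_closed_ball_dist_add_le_two_mul_sub X (half_pos hε) D
    have hsmall : ∀ᶠ n : ℕ in atTop, 2 * (D - d n) + 2 * (1 / ((n : ℝ) + 1)) < δ := by
      have : Tendsto (fun n : ℕ => 2 * (D - d n) + 2 * (1 / ((n : ℝ) + 1))) atTop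
          (𝓝 (2 * (D - D) + 2 * 0)) :=
        ((tendsto_const_nhds.sub hd_lim).const_mul 2).add
          (tendsto_one_div_add_atTop_nhds_zero_nat.const_mul 2)
      exact this.eventually_lt_const (by simpa using hδ)
    have hsmall' : ∀ᶠ n : ℕ in atTop, 1 / ((n : ℝ) + 1) < ε / 4 :=
      tendsto_one_div_add_atTop_nhds_zero_nat.eventually_lt_const (by linarith)
    obtain ⟨K, hK, hK'⟩ := (hsmall.and hsmall').exists
    refine ⟨K, fun m hm => ?_⟩
    by_contra! hfar
    have hmK : 1 / ((m : ℝ) + 1) ≤ 1 / ((K : ℝ) + 1) := Nat.one_div_le_one_div hm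
    obtain ⟨u, hu, hxu⟩ := hshrink _ (hη K) (x m) (by linarith [hxlt m, hdD m])
    obtain ⟨v, hv, hxv⟩ := hshrink _ (hη K) (x K) (by linarith [hxlt K, hdD K])
    have huv : ε / 2 ≤ ‖u - v‖ := by
      have h1 : ‖x m - x K‖ ≤ ‖x m - u‖ + ‖u - v‖ + ‖x K - v‖ := by
        have : x m - x K = (x m - u) + (u - v) - (x K - v) := by abel
        rw [this]
        exact (norm_sub_le _ _).trans (by gcongr; exact norm_add_le _ _)
      rw [dist_eq_norm] at hfar
      linarith
    have hsum := hconv hu hv huv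
    have h2 : ‖x m + x K‖ ≤ ‖u + v‖ + ‖x m - u‖ + ‖x K - v‖ := by
      have : x m + x K = (u + v) + (x m - u) + (x K - v) := by abel
      rw [this]
      exact (norm_add_le _ _).trans (by gcongr; exact norm_add_le _ _)
    have h3 := hd_le K _ (hmid K _ (hanti hm (hxC m)) _ (hxC K))
    rw [norm_smul, Real.norm_of_nonneg (by norm_num)] at h3
    linarith
  obtain ⟨y, hy⟩ := cauchySeq_tendsto_of_complete hcauchy
  exact ⟨y, fun n => (hclosed n).mem_of_tendsto hy
    (eventually_atTop.2 ⟨n, fun m hm => hanti hm (hxC m)⟩)⟩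

namespace IsUFunction

variable {X : Type*} [NormedAddCommGroup X] [NormedSpace ℝ X] {f : X → ℝ}

theorem midpoint_le (hf : IsUFunction f) (x y : X) :
    f ((2⁻¹ : ℝ) • (x + y)) ≤ 2⁻¹ * (f x + f y) := by
  rcases eq_or_ne x y with rfl | h
  · rw [← two_smul ℝ x, inv_smul_smul₀ two_ne_zero]
    linarith
  · exact (hf.strictConvex x y h).le

theorem bddBelow_range (hf : IsUFunction f) : BddBelow (range f) := by
  obtain ⟨m, hm⟩ := (hf.bounded _ (hf.coercive 0)).bddBelow
  refine ⟨min m 0, ?_⟩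
  rintro _ ⟨x, rfl⟩
  rcases le_total (f x) 0 with h | h
  · exact (min_le_left _ _).trans (hm ⟨x, h, rfl⟩)
  · exact (min_le_right _ _).trans h

theorem existsUnique_isMinOn [CompleteSpace X] [UniformConvexSpace X] (hf : IsUFunction f) :
    ∃! x, IsMinOn f univ x := by
  have hη : ∀ n : ℕ, (0 : ℝ) < 1 / ((n : ℝ) + 1) := fun n => Nat.one_div_pos_of_nat
  obtain ⟨x, hx⟩ := exists_mem_forall_of_antitone_midpoint_mem
    (C := fun n : ℕ => {x : X | f x ≤ (⨅ y, f y) + 1 / ((n : ℝ) + 1)})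
    (fun m n hmn x (hx : f x ≤ (⨅ y, f y) + 1 / ((n : ℝ) + 1)) =>
      hx.trans (by linarith [Nat.one_div_le_one_div (α := ℝ) hmn]))
    (fun n => by
      obtain ⟨x, hx⟩ := exists_lt_of_ciInf_lt (lt_add_of_pos_right (⨅ y, f y) (hη n))
      exact ⟨x, hx.le⟩)
    (fun n => isClosed_le hf.continuous continuous_const)
    (hf.coercive _)
    (fun n x (hx : f x ≤ (⨅ y, f y) + 1 / ((n : ℝ) + 1)) y
      (hy : f y ≤ (⨅ y, f y) + 1 / ((n : ℝ) + 1)) => (hf.midpoint_le x y).trans (by linarith))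
  have hmin : f x ≤ ⨅ y, f y := by
    have := (tendsto_one_div_add_atTop_nhds_zero_nat (𝕜 := ℝ)).const_add (⨅ y, f y)
    rw [add_zero] at this
    exact ge_of_tendsto' this hx
  refine ⟨x, fun y _ => hmin.trans (ciInf_le hf.bddBelow_range y), fun y hy => ?_⟩
  by_contra hne
  have h1 := hf.strictConvex y x hne
  have h2 := isMinOn_iff.1 hy _ (mem_univ ((2⁻¹ : ℝ) • (y + x)))
  have h3 := isMinOn_iff.1 hy _ (mem_univ x)
  have h4 := ciInf_le hf.bddBelow_range y
  linarith

/-- A Gâteaux derivative of a U-function is a subgradient. Only midpoint convexity is available,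
so the difference quotients are taken along the dyadic step sizes `2⁻ᵏ`. -/
theorem mem_subdifferentialAt (hf : IsUFunction f) {x : X} {φ : StrongDual ℝ X}
    (hφ : ∀ v, HasLineDerivAt ℝ f (φ v) x v) : φ ∈ subdifferentialAt f x := by
  intro y
  have hdyadic : ∀ k : ℕ,
      f (x + ((2⁻¹ : ℝ) ^ k) • (y - x)) ≤ f x + (2⁻¹ : ℝ) ^ k * (f y - f x) := by
    intro k
    induction k with
    | zero => simp
    | succ k ih =>
      have h := hf.midpoint_le x (x + ((2⁻¹ : ℝ) ^ k) • (y - x))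
      have heq : (2⁻¹ : ℝ) • (x + (x + ((2⁻¹ : ℝ) ^ k) • (y - x)))
          = x + ((2⁻¹ : ℝ) ^ (k + 1)) • (y - x) := by
        rw [← add_assoc, ← two_smul ℝ x, smul_add, inv_smul_smul₀ two_ne_zero, smul_smul, pow_succ']
      rw [heq] at h
      have hpow : (2⁻¹ : ℝ) ^ (k + 1) * (f y - f x) = 2⁻¹ * (2⁻¹ ^ k * (f y - f x)) := by ring
      linarith
  have hlim : Tendsto (fun k : ℕ => ((2⁻¹ : ℝ) ^ k)⁻¹ •
      (f (x + ((2⁻¹ : ℝ) ^ k) • (y - x)) - f x)) atTop (𝓝 (φ (y - x))) := by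
    have h := (hφ (y - x)).tendsto_slope_zero_right
    have hpow : Tendsto (fun k : ℕ => (2⁻¹ : ℝ) ^ k) atTop (𝓝[>] 0) :=
      tendsto_nhdsWithin_iff.2 ⟨tendsto_pow_atTop_nhds_zero_of_lt_one (by norm_num) (by norm_num),
        Eventually.of_forall fun k => by simp⟩
    exact h.comp hpow
  have hle : φ (y - x) ≤ f y - f x := le_of_tendsto' hlim fun k => by
    rw [smul_eq_mul, inv_mul_le_iff₀ (by positivity)]
    linarith [hdyadic k]
  linarith

end IsUFunction

theorem isMinOn_argmin {X : Type*} [NormedAddCommGroup X] {g : X → ℝ}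
    (h : ∃! x, IsMinOn g univ x) :
    IsMinOn g univ (argmin g) :=
  Classical.epsilon_spec h.exists

theorem argmin_eq_of_isMinOn {X : Type*} [NormedAddCommGroup X] {g : X → ℝ}
    (h : ∃! x, IsMinOn g univ x) {x : X}
    (hx : IsMinOn g univ x) : argmin g = x :=
  h.unique (isMinOn_argmin h) hx

/-! ### Stability of minimum points of convex combinations -/

theorem exists_pos_of_mem_stdSimplex {N : ℕ} {t : Fin N → ℝ} (ht : t ∈ stdSimplex ℝ (Fin N)) :
    ∃ i, 0 < t i := by
  by_contra! h
  have h1 : ∑ i, t i ≤ 0 := Finset.sum_nonpos fun i _ => h i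
  linarith [ht.2]

/-- A convex combination of numbers is at least one of them. -/
theorem exists_le_weightedSum {X : Type*} {N : ℕ} {f : Fin N → X → ℝ} {t : Fin N → ℝ}
    (ht : t ∈ stdSimplex ℝ (Fin N)) (x : X) :
    ∃ i, f i x ≤ weightedSum f t x := by
  by_contra! h
  obtain ⟨j, hj⟩ := exists_pos_of_mem_stdSimplex ht
  have h1 : ∑ i, t i * weightedSum f t x < ∑ i, t i * f i x :=
    Finset.sum_lt_sum (fun i _ => mul_le_mul_of_nonneg_left (h i).le (ht.1 i))
      ⟨j, Finset.mem_univ j, mul_lt_mul_of_pos_left (h j) hj⟩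
  rw [← Finset.sum_mul, ht.2, one_mul] at h1
  exact lt_irrefl _ h1

theorem abs_weightedSum_sub_le {X : Type*} {N : ℕ} {f : Fin N → X → ℝ}
    {s t : Fin N → ℝ} {x : X} {K : ℝ} (hK : ∀ i, |f i x| ≤ K) :
    |weightedSum f s x - weightedSum f t x| ≤ (∑ i, |s i - t i|) * K := by
  rw [weightedSum, weightedSum, ← Finset.sum_sub_distrib, Finset.sum_mul]
  refine (Finset.abs_sum_le_sum_abs _ _).trans (Finset.sum_le_sum fun i _ => ?_)
  rw [← sub_mul, abs_mul]
  exact mul_le_mul_of_nonneg_left (hK i) (abs_nonneg _)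

section Stability

variable {X : Type*} [NormedAddCommGroup X] [NormedSpace ℝ X] {N : ℕ} {f : Fin N → X → ℝ}

theorem isBounded_setOf_exists_le (hU : ∀ i, IsUFunction (f i)) (C : ℝ) :
    Bornology.IsBounded {x : X | ∃ i, f i x ≤ C} := by
  rw [show {x : X | ∃ i, f i x ≤ C} = ⋃ i, {x | f i x ≤ C} by ext; simp]
  exact Bornology.isBounded_iUnion.2 fun i => (hU i).coercive C

theorem exists_forall_abs_le (hU : ∀ i, IsUFunction (f i)) {B : Set X}
    (hB : Bornology.IsBounded B) : ∃ K, ∀ i, ∀ x ∈ B, |f i x| ≤ K := by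
  obtain ⟨K, hK⟩ := (Bornology.isBounded_iUnion.2 fun i => (hU i).bounded B hB).exists_norm_le
  exact ⟨K, fun i x hx => hK _ (mem_iUnion.2 ⟨i, x, hx, rfl⟩)⟩

theorem IsUFunction.weightedSum (hU : ∀ i, IsUFunction (f i)) {t : Fin N → ℝ}
    (ht : t ∈ stdSimplex ℝ (Fin N)) : IsUFunction (weightedSum f t) where
  continuous := continuous_finsetSum _ fun i _ => (hU i).continuous.const_mul (t i)
  strictConvex x y hxy := by
    obtain ⟨j, hj⟩ := exists_pos_of_mem_stdSimplex ht
    have h : ∑ i, t i * f i ((2⁻¹ : ℝ) • (x + y)) < ∑ i, t i * (2⁻¹ * (f i x + f i y)) :=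
      Finset.sum_lt_sum
        (fun i _ => mul_le_mul_of_nonneg_left ((hU i).midpoint_le x y) (ht.1 i))
        ⟨j, Finset.mem_univ j, mul_lt_mul_of_pos_left ((hU j).strictConvex x y hxy) hj⟩
    refine h.trans_eq ?_
    simp only [_root_.weightedSum, ← Finset.sum_add_distrib, Finset.mul_sum]
    exact Finset.sum_congr rfl fun i _ => by ring
  bounded B hB := by
    obtain ⟨K, hK⟩ := exists_forall_abs_le hU hB
    refine isBounded_iff_forall_norm_le.2 ⟨K, ?_⟩
    rintro _ ⟨x, hx, rfl⟩
    calc ‖∑ i, t i * f i x‖ ≤ ∑ i, ‖t i * f i x‖ := norm_sum_le _ _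
      _ ≤ ∑ i, t i * K := Finset.sum_le_sum fun i _ => by
          rw [norm_mul, Real.norm_of_nonneg (ht.1 i)]
          exact mul_le_mul_of_nonneg_left (hK i x hx) (ht.1 i)
      _ = K := by rw [← Finset.sum_mul, ht.2, one_mul]
  coercive C := (isBounded_setOf_exists_le hU C).subset fun x (hx : _ ≤ C) =>
    (exists_le_weightedSum ht x).imp fun _ hi => hi.trans hx

theorem existsUnique_isMinOn_weightedSum [CompleteSpace X] [UniformConvexSpace X]
    (hU : ∀ i, IsUFunction (f i)) {t : Fin N → ℝ} (ht : t ∈ stdSimplex ℝ (Fin N)) :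
    ∃! x, IsMinOn (weightedSum f t) univ x :=
  (IsUFunction.weightedSum hU ht).existsUnique_isMinOn

theorem exists_forall_norm_argmin_weightedSum_le [CompleteSpace X] [UniformConvexSpace X]
    (hU : ∀ i, IsUFunction (f i)) :
    ∃ R, ∀ t ∈ stdSimplex ℝ (Fin N), ‖argmin (weightedSum f t)‖ ≤ R := by
  obtain ⟨K, hK⟩ := exists_forall_abs_le hU (Bornology.isBounded_singleton (x := (0 : X)))
  obtain ⟨R, hR⟩ := (isBounded_setOf_exists_le hU K).exists_norm_le
  refine ⟨R, fun t ht => hR _ ?_⟩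
  refine (exists_le_weightedSum ht _).imp fun i hi => hi.trans ?_
  calc weightedSum f t (argmin (weightedSum f t)) ≤ weightedSum f t 0 :=
        isMinOn_argmin (existsUnique_isMinOn_weightedSum hU ht) (mem_univ 0)
    _ ≤ ∑ i, t i * K := Finset.sum_le_sum fun i _ =>
        mul_le_mul_of_nonneg_left ((le_abs_self _).trans (hK i 0 rfl)) (ht.1 i)
    _ = K := by rw [← Finset.sum_mul, ht.2, one_mul]

/-- Minimizing sequences of `u_t` converge to the minimum point `x`. The Gâteaux derivatives `φ i`
of the `f i` at `x` satisfy `∑ i, t i • φ i = 0`, so that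
`u_t y - u_t x = ∑ i, t i * (f i y - f i x - φ i (y - x))` with all summands nonnegative.
Along a minimizing sequence each summand tends to zero, and the small diameter property
of any one `f i` with `t i ≠ 0` applies. -/
theorem tendsto_of_tendsto_weightedSum (hU : ∀ i, IsUFunction (f i))
    (hG : ∀ i x, GateauxDifferentiableAt (f i) x) (hS : ∀ i, HasSmallDiameterProperty (f i))
    {t : Fin N → ℝ} (ht : t ∈ stdSimplex ℝ (Fin N)) {x : X}
    (hx : IsMinOn (weightedSum f t) univ x)
    (huniq : ∀ y, IsMinOn (weightedSum f t) univ y → y = x) {y : ℕ → X}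
    (hy : Tendsto (fun n => weightedSum f t (y n)) atTop (𝓝 (weightedSum f t x))) :
    Tendsto y atTop (𝓝 x) := by
  choose φ hφ using fun i => hG i x
  have hzero : ∀ v, ∑ i, t i * φ i v = 0 := fun v => by
    have hderiv : HasDerivAt (fun s : ℝ => weightedSum f t (x + s • v)) (∑ i, t i * φ i v) 0 :=
      HasDerivAt.fun_sum fun i _ => (hφ i v).const_mul (t i)
    refine IsLocalMin.hasDerivAt_eq_zero (Eventually.of_forall fun s => ?_) hderiv
    simpa using hx (mem_univ (x + s • v))
  have hsub : ∀ i, φ i ∈ subdifferentialAt (f i) x := fun i => (hU i).mem_subdifferentialAt (hφ i)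
  have hgap : ∀ i z, 0 ≤ t i * (f i z - f i x - φ i (z - x)) := fun i z =>
    mul_nonneg (ht.1 i) (by linarith [hsub i z])
  have hsum : ∀ z, weightedSum f t z - weightedSum f t x
      = ∑ i, t i * (f i z - f i x - φ i (z - x)) := fun z => by
    simp only [mul_sub (t _), Finset.sum_sub_distrib, hzero, sub_zero, weightedSum]
  obtain ⟨j, hj⟩ := exists_pos_of_mem_stdSimplex ht
  have hgap_lim : Tendsto (fun n => t j * (f j (y n) - f j x - φ j (y n - x))) atTop (𝓝 0) := by
    refine squeeze_zero (fun n => hgap j (y n)) (fun n => ?_)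
      (by simpa using hy.sub_const (weightedSum f t x))
    rw [hsum]
    exact Finset.single_le_sum (f := fun i => t i * (f i (y n) - f i x - φ i (y n - x)))
      (fun i _ => hgap i (y n)) (Finset.mem_univ j)
  have hlim : Tendsto (fun n => φ j (y n) - f j (y n)) atTop (𝓝 (φ j x - f j x)) := by
    have h := (hgap_lim.const_mul (t j)⁻¹).const_sub (φ j x - f j x)
    rw [mul_zero, sub_zero] at h
    refine h.congr fun n => ?_
    rw [inv_mul_cancel_left₀ hj.ne', map_sub]
    ring
  obtain ⟨z, hz⟩ := hS j x (φ j) (hsub j) y hlim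
  have hval : weightedSum f t z = weightedSum f t x :=
    tendsto_nhds_unique (((IsUFunction.weightedSum hU ht).continuous.tendsto z).comp hz) hy
  have hzmin : IsMinOn (weightedSum f t) univ z := fun w hw => by
    simpa only [mem_ofPred_eq, hval] using hx hw
  rwa [huniq z hzmin] at hz

theorem continuousOn_argmin_weightedSum [CompleteSpace X] [UniformConvexSpace X]
    (hU : ∀ i, IsUFunction (f i)) (hG : ∀ i x, GateauxDifferentiableAt (f i) x)
    (hS : ∀ i, HasSmallDiameterProperty (f i)) :
    ContinuousOn (fun t => argmin (weightedSum f t)) (stdSimplex ℝ (Fin N)) := by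
  intro t ht
  have hmin : ∀ s ∈ stdSimplex ℝ (Fin N),
      IsMinOn (weightedSum f s) univ (argmin (weightedSum f s)) := fun s hs =>
    isMinOn_argmin (existsUnique_isMinOn_weightedSum hU hs)
  obtain ⟨R, hR⟩ := exists_forall_norm_argmin_weightedSum_le hU
  obtain ⟨K, hK⟩ := exists_forall_abs_le hU (Metric.isBounded_closedBall (x := (0 : X)) (r := R))
  have hK' : ∀ s ∈ stdSimplex ℝ (Fin N), ∀ i, |f i (argmin (weightedSum f s))| ≤ K :=
    fun s hs i => hK i _ (by simpa using hR s hs)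
  have hle : ∀ s ∈ stdSimplex ℝ (Fin N), weightedSum f t (argmin (weightedSum f s))
      ≤ weightedSum f t (argmin (weightedSum f t)) + 2 * ((∑ i, |s i - t i|) * K) := by
    intro s hs
    have h1 := abs_le.1 (abs_weightedSum_sub_le (s := s) (t := t) (hK' s hs))
    have h2 := abs_le.1 (abs_weightedSum_sub_le (s := s) (t := t) (hK' t ht))
    have h3 := isMinOn_iff.1 (hmin s hs) (argmin (weightedSum f t)) (mem_univ _)
    linarith
  have hlim : Tendsto (fun s => weightedSum f t (argmin (weightedSum f s)))
      (𝓝[stdSimplex ℝ (Fin N)] t) (𝓝 (weightedSum f t (argmin (weightedSum f t)))) := by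
    have hcont : Continuous fun s : Fin N → ℝ =>
        weightedSum f t (argmin (weightedSum f t)) + 2 * ((∑ i, |s i - t i|) * K) := by fun_prop
    refine tendsto_of_tendsto_of_tendsto_of_le_of_le' tendsto_const_nhds
      (by simpa using (hcont.tendsto t).mono_left nhdsWithin_le_nhds)
      (Eventually.of_forall fun s => hmin t ht (mem_univ _))
      (eventually_nhdsWithin_of_forall hle)
  refine tendsto_of_seq_tendsto fun s hs => ?_
  exact tendsto_of_tendsto_weightedSum hU hG hS ht (hmin t ht)
    (fun y hy => (argmin_eq_of_isMinOn (existsUnique_isMinOn_weightedSum hU ht) hy).symm)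
    (hlim.comp hs)

/-- A quadratic modulus of continuity up to a prescribed error. It turns a bound
on the second moments of `s - t` into a bound on the mean distance of the minimum points. -/
theorem exists_forall_norm_argmin_sub_le [CompleteSpace X] [UniformConvexSpace X]
    (hU : ∀ i, IsUFunction (f i)) (hG : ∀ i x, GateauxDifferentiableAt (f i) x)
    (hS : ∀ i, HasSmallDiameterProperty (f i)) {δ : ℝ} (hδ : 0 < δ) :
    ∃ C, 0 ≤ C ∧ ∀ s ∈ stdSimplex ℝ (Fin N), ∀ t ∈ stdSimplex ℝ (Fin N),
      ‖argmin (weightedSum f s) - argmin (weightedSum f t)‖ ≤ δ + C * ∑ i, (s i - t i) ^ 2 := by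
  obtain ⟨R, hR⟩ := exists_forall_norm_argmin_weightedSum_le hU
  obtain ⟨η, hη, hunif⟩ := Metric.uniformContinuousOn_iff.1
    ((isCompact_stdSimplex ℝ (Fin N)).uniformContinuousOn_of_continuous
      (continuousOn_argmin_weightedSum hU hG hS)) δ hδ
  refine ⟨2 * |R| / η ^ 2, by positivity, fun s hs t ht => ?_⟩
  have hsum : 0 ≤ ∑ i, (s i - t i) ^ 2 := Finset.sum_nonneg fun i _ => sq_nonneg _
  rcases lt_or_ge (dist s t) η with h | h
  · have h1 := hunif s hs t ht h
    rw [dist_eq_norm] at h1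
    have : 0 ≤ 2 * |R| / η ^ 2 * ∑ i, (s i - t i) ^ 2 := by positivity
    linarith
  · have hfar : ∃ i, η ≤ dist (s i) (t i) := by
      by_contra! hlt
      exact h.not_gt ((dist_pi_lt_iff hη).2 hlt)
    obtain ⟨i, hi⟩ := hfar
    have h1 : η ^ 2 ≤ ∑ i, (s i - t i) ^ 2 := by
      refine le_trans ?_ (Finset.single_le_sum (f := fun i => (s i - t i) ^ 2)
        (fun i _ => sq_nonneg _) (Finset.mem_univ i))
      rw [← sq_abs (s i - t i)]
      exact pow_le_pow_left₀ hη.le hi 2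
    have h2 : 2 * |R| ≤ 2 * |R| / η ^ 2 * ∑ i, (s i - t i) ^ 2 := by
      rw [div_mul_eq_mul_div, le_div_iff₀ (by positivity)]
      exact mul_le_mul_of_nonneg_left h1 (by positivity)
    have h3 := norm_sub_le (argmin (weightedSum f s)) (argmin (weightedSum f t))
    linarith [hR s hs, hR t ht, le_abs_self R]

end Stability

/-! ### Empirical frequencies -/

/-- The relative frequency with which each index occurs among `I 0 ω, …, I (n - 1) ω`. -/
noncomputable def empiricalFrequency {Ω : Type*} {N : ℕ} (I : ℕ → Ω → Fin N) (n : ℕ) (ω : Ω) :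
    Fin N → ℝ :=
  fun j => (1 / (n : ℝ)) * ∑ k ∈ Finset.range n, if I k ω = j then 1 else 0

section EmpiricalFrequency

variable {Ω : Type*} {N : ℕ}

theorem empiricalFrequency_mem_stdSimplex (I : ℕ → Ω → Fin N) {n : ℕ} (hn : 1 ≤ n) (ω : Ω) :
    empiricalFrequency I n ω ∈ stdSimplex ℝ (Fin N) := by
  refine ⟨fun j => ?_, ?_⟩
  · exact mul_nonneg (by positivity) (Finset.sum_nonneg fun k _ => by split_ifs <;> norm_num)
  · have hn' : (n : ℝ) ≠ 0 := by positivity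
    simp only [empiricalFrequency]
    rw [← Finset.mul_sum, Finset.sum_comm]
    simp [hn']

theorem weightedSum_empiricalFrequency {X : Type*} (f : Fin N → X → ℝ) (I : ℕ → Ω → Fin N) (n : ℕ)
    (ω : Ω) : weightedSum f (empiricalFrequency I n ω) =
      empiricalMean (fun k ω => f (I k ω)) n ω := by
  ext x
  simp only [weightedSum, empiricalFrequency, empiricalMean, mul_assoc]
  rw [← Finset.mul_sum]
  simp only [Finset.sum_mul]
  rw [Finset.sum_comm]
  simp

variable [MeasurableSpace Ω] {μ : Measure Ω} [IsProbabilityMeasure μ]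

theorem stronglyMeasurable_comp_empiricalFrequency {Y : Type*} [TopologicalSpace Y]
    {I : ℕ → Ω → Fin N} (hI : ∀ k, Measurable (I k)) (n : ℕ) (g : (Fin N → ℝ) → Y) :
    StronglyMeasurable fun ω => g (empiricalFrequency I n ω) := by
  -- The frequencies depend only on the first `n` indices, which form a discrete random variable.
  have hmeas : Measurable fun ω (k : Fin n) => I k ω := measurable_pi_lambda _ fun k => hI k
  have h : StronglyMeasurable fun i : Fin n → Fin N =>
      g fun j => (1 / (n : ℝ)) * ∑ k, if i k = j then 1 else 0 := .of_discrete
  convert h.comp_measurable hmeas using 1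
  ext ω
  simp only [Function.comp_apply]
  congr 1
  ext j
  rw [empiricalFrequency, Finset.sum_range]

/-- The mean square deviation of the relative frequencies in `n` independent trials from the
probabilities is at most `1 / n`, whatever the probabilities are. -/
theorem integral_empiricalFrequency_sub_sq_le {I : ℕ → Ω → Fin N} {t : Fin N → ℝ}
    (hI : ∀ k, Measurable (I k)) (hindep : iIndepFun I μ)
    (hlaw : ∀ k j, μ.real (I k ⁻¹' {j}) = t j) {n : ℕ} (hn : 1 ≤ n) (j : Fin N) :
    ∫ ω, (empiricalFrequency I n ω j - t j) ^ 2 ∂μ ≤ 1 / (n : ℝ) := by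
  have hn' : (n : ℝ) ≠ 0 := by positivity
  set φ : Fin N → ℝ := fun i => if i = j then 1 else 0 with hφ
  have hφm : Measurable φ := .of_discrete
  set Y : ℕ → Ω → ℝ := fun k ω => φ (I k ω) with hY
  have hYm : ∀ k, Measurable (Y k) := fun k => hφm.comp (hI k)
  have hYmem : ∀ k ω, Y k ω ∈ Icc (0 : ℝ) 1 := fun k ω => by
    simp only [hY, hφ]
    split_ifs <;> norm_num
  have hYL : ∀ k, MemLp (Y k) 2 μ := fun k =>
    MemLp.of_bound (hYm k).aestronglyMeasurable 1 (.of_forall fun ω => by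
      rw [Real.norm_of_nonneg (hYmem k ω).1]
      exact (hYmem k ω).2)
  have hYint : ∀ k, ∫ ω, Y k ω ∂μ = t j := fun k => by
    rw [← hlaw k j, ← integral_indicator_one (hI k (measurableSet_singleton j))]
    refine integral_congr_ae (.of_forall fun ω => ?_)
    by_cases hj : I k ω = j <;> simp [hY, hφ, hj]
  have hYvar : ∀ k, variance (Y k) μ ≤ 1 := fun k =>
    (variance_le_sq_of_bounded (.of_forall (hYmem k)) (hYm k).aemeasurable).trans (by norm_num)
  have hYindep : iIndepFun Y μ := hindep.comp (fun _ => φ) fun _ => hφm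
  have hfreq : (fun ω => empiricalFrequency I n ω j)
      = fun ω => (1 / (n : ℝ)) * (∑ k ∈ Finset.range n, Y k) ω := by
    ext ω
    simp [empiricalFrequency, hY, hφ]
  have hmean : ∫ ω, empiricalFrequency I n ω j ∂μ = t j := by
    rw [hfreq, integral_const_mul]
    simp only [Finset.sum_apply]
    rw [integral_finsetSum _ fun k _ => (hYL k).integrable (by norm_num)]
    simp [hYint, hn']
  have hm : Measurable fun ω => empiricalFrequency I n ω j :=
    (stronglyMeasurable_comp_empiricalFrequency hI n fun s => s j).measurable
  calc ∫ ω, (empiricalFrequency I n ω j - t j) ^ 2 ∂μ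
      = variance (fun ω => empiricalFrequency I n ω j) μ := by
        rw [variance_eq_integral hm.aemeasurable, hmean]
    _ = (1 / (n : ℝ)) ^ 2 * ∑ k ∈ Finset.range n, variance (Y k) μ := by
        rw [hfreq, variance_const_mul, IndepFun.variance_sum (fun k _ => hYL k)
          fun i _ k _ hik => hYindep.indepFun hik]
    _ ≤ (1 / (n : ℝ)) ^ 2 * ∑ k ∈ Finset.range n, 1 := by
        gcongr with k
        exact hYvar k
    _ = 1 / (n : ℝ) := by
        simp only [Finset.sum_const, Finset.card_range, nsmul_eq_mul, mul_one]
        field_simp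

end EmpiricalFrequency

namespace IsRandomSample

variable {X : Type*} {N : ℕ} {f : Fin N → X → ℝ} {t : Fin N → ℝ}
  {Ω : Type*} [MeasurableSpace Ω] {μ : Measure Ω} {F : ℕ → Ω → X → ℝ}

theorem measure_preimage (h : IsRandomSample f t μ F) (k : ℕ) (S : Set (X → ℝ)) :
    μ (F k ⁻¹' S) = ∑ i, ENNReal.ofReal (t i) * S.indicator 1 (f i) := by
  let _ : MeasurableSpace (X → ℝ) := ⊤
  have hS : MeasurableSet S := trivial
  have hF : Measurable (F k) := h.measurable k
  have hlaw : Measure.map (F k) μ = ∑ i, ENNReal.ofReal (t i) • Measure.dirac (f i) := h.law k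
  rw [← Measure.map_apply hF hS, hlaw, Measure.finsetSum_apply]
  simp [Measure.dirac_apply' _ hS]

/-- A random sample of functions comes from a random sample of indices. If some of the `f i`
coincide, the function does not determine the index, so one index is selected for each function;
this changes the weights to `t'`, but not the weighted sum. -/
theorem exists_index (h : IsRandomSample f t μ F) (ht : t ∈ stdSimplex ℝ (Fin N)) :
    ∃ t' ∈ stdSimplex ℝ (Fin N), weightedSum f t' = weightedSum f t ∧
      ∃ I : ℕ → Ω → Fin N, (∀ k, Measurable (I k)) ∧ iIndepFun I μ ∧
        (∀ k j, μ.real (I k ⁻¹' {j}) = t' j) ∧ ∀ᵐ ω ∂μ, ∀ k, F k ω = f (I k ω) := by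
  obtain ⟨i₀, -⟩ := exists_pos_of_mem_stdSimplex ht
  have : Nonempty (Fin N) := ⟨i₀⟩
  set g : (X → ℝ) → Fin N := Function.invFun f with hg
  have hfg : ∀ u ∈ range f, f (g u) = u := fun u hu => Function.invFun_eq hu
  set t' : Fin N → ℝ := fun j => ∑ i, if g (f i) = j then t i else 0 with ht'
  have hnonneg : ∀ i j, 0 ≤ if g (f i) = j then t i else 0 := fun i j => by
    split_ifs
    exacts [ht.1 i, le_rfl]
  refine ⟨t', ⟨fun j => Finset.sum_nonneg fun i _ => hnonneg i j, ?_⟩, ?_,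
    fun k ω => g (F k ω), fun k => ?_, ?_, fun k j => ?_, ?_⟩
  · rw [Finset.sum_comm]
    simpa using ht.2
  · ext x
    simp only [weightedSum, ht', Finset.sum_mul]
    rw [Finset.sum_comm]
    refine Finset.sum_congr rfl fun i _ => ?_
    simp [ite_mul, hfg (f i) ⟨i, rfl⟩]
  · exact (@measurable_from_top _ _ _ g).comp (h.measurable k)
  · exact h.indep.comp (fun _ => g) fun _ => measurable_from_top
  · have hpre : (fun ω => g (F k ω)) ⁻¹' {j} = F k ⁻¹' (g ⁻¹' {j}) := rfl
    rw [measureReal_def, hpre, h.measure_preimage, ENNReal.toReal_sum]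
    · refine Finset.sum_congr rfl fun i _ => ?_
      by_cases hij : g (f i) = j <;> simp [hij, ht.1 i]
    · intro i _
      by_cases hij : g (f i) = j <;> simp [hij]
  · refine ae_all_iff.2 fun k => ?_
    have hnull : μ (F k ⁻¹' (range f)ᶜ) = 0 := by
      rw [h.measure_preimage]
      simp
    filter_upwards [compl_mem_ae_iff.2 hnull] with ω hω
    exact (hfg _ (by simpa using hω)).symm

end IsRandomSample

/-! ### The mean distance of empirical minimum points -/

/-- For each admissible pair of an error `δ` and a constant `C` in the modulus of continuity of the
minimum point, the mean distance is at most `δ + C * N / n`. -/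
theorem IsRandomSample.integral_norm_argmin_sub_le {X : Type*} [NormedAddCommGroup X]
    [NormedSpace ℝ X] [CompleteSpace X] [UniformConvexSpace X] {N : ℕ} {f : Fin N → X → ℝ}
    (hU : ∀ i, IsUFunction (f i)) {t : Fin N → ℝ} (ht : t ∈ stdSimplex ℝ (Fin N)) {Ω : Type*}
    [MeasurableSpace Ω] {μ : Measure Ω} [IsProbabilityMeasure μ] {F : ℕ → Ω → X → ℝ}
    (hF : IsRandomSample f t μ F) {n : ℕ} (hn : 1 ≤ n) :
    (∀ᵐ ω ∂μ, ∃! x, IsMinOn (empiricalMean F n ω) univ x) ∧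
    Integrable (fun ω => ‖argmin (empiricalMean F n ω) - argmin (weightedSum f t)‖) μ ∧
    ∀ δ C : ℝ, 0 ≤ C →
      (∀ s ∈ stdSimplex ℝ (Fin N), ∀ t ∈ stdSimplex ℝ (Fin N),
        ‖argmin (weightedSum f s) - argmin (weightedSum f t)‖ ≤ δ + C * ∑ i, (s i - t i) ^ 2) →
      ∫ ω, ‖argmin (empiricalMean F n ω) - argmin (weightedSum f t)‖ ∂μ ≤ δ + C * N / n := by
  obtain ⟨t', ht', hsum, I, hIm, hindep, hlaw, hFI⟩ := hF.exists_index ht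
  rw [← hsum]
  have hs : ∀ ω, empiricalFrequency I n ω ∈ stdSimplex ℝ (Fin N) :=
    empiricalFrequency_mem_stdSimplex I hn
  have hmean : ∀ᵐ ω ∂μ, empiricalMean F n ω = weightedSum f (empiricalFrequency I n ω) := by
    filter_upwards [hFI] with ω hω
    rw [weightedSum_empiricalFrequency]
    ext x
    simp only [empiricalMean, hω]
  have hae : (fun ω => ‖argmin (empiricalMean F n ω) - argmin (weightedSum f t')‖) =ᵐ[μ]
      fun ω => ‖argmin (weightedSum f (empiricalFrequency I n ω)) - argmin (weightedSum f t')‖ := by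
    filter_upwards [hmean] with ω hω
    rw [hω]
  have hint : Integrable (fun ω =>
      ‖argmin (weightedSum f (empiricalFrequency I n ω)) - argmin (weightedSum f t')‖) μ := by
    obtain ⟨R, hR⟩ := exists_forall_norm_argmin_weightedSum_le hU
    refine Integrable.of_bound (stronglyMeasurable_comp_empiricalFrequency hIm n fun s =>
      ‖argmin (weightedSum f s) - argmin (weightedSum f t')‖).aestronglyMeasurable (R + R)
      (.of_forall fun ω => ?_)
    rw [norm_norm]
    exact (norm_sub_le _ _).trans (add_le_add (hR _ (hs ω)) (hR _ ht'))
  refine ⟨?_, hint.congr hae.symm, fun δ C hC hmod => ?_⟩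
  · filter_upwards [hmean] with ω hω
    rw [hω]
    exact existsUnique_isMinOn_weightedSum hU (hs ω)
  · have hsq : ∀ i, Integrable (fun ω => (empiricalFrequency I n ω i - t' i) ^ 2) μ := fun i => by
      refine Integrable.of_bound (stronglyMeasurable_comp_empiricalFrequency hIm n fun s =>
        (s i - t' i) ^ 2).aestronglyMeasurable 1 (.of_forall fun ω => ?_)
      have h1 := mem_Icc_of_mem_stdSimplex (hs ω) i
      have h2 := mem_Icc_of_mem_stdSimplex ht' i
      rw [norm_pow, Real.norm_eq_abs]
      exact pow_le_one₀ (abs_nonneg _) (abs_le.2 ⟨by linarith [h1.1, h2.2], by linarith [h1.2, h2.1]⟩)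
    calc ∫ ω, ‖argmin (empiricalMean F n ω) - argmin (weightedSum f t')‖ ∂μ
        = ∫ ω, ‖argmin (weightedSum f (empiricalFrequency I n ω)) -
            argmin (weightedSum f t')‖ ∂μ := integral_congr_ae hae
      _ ≤ ∫ ω, (δ + C * ∑ i, (empiricalFrequency I n ω i - t' i) ^ 2) ∂μ :=
          integral_mono hint ((integrable_const δ).add
            ((integrable_finsetSum _ fun i _ => hsq i).const_mul C)) fun ω => hmod _ (hs ω) _ ht'
      _ = δ + C * ∑ i, ∫ ω, (empiricalFrequency I n ω i - t' i) ^ 2 ∂μ := by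
          rw [integral_add (integrable_const δ)
            ((integrable_finsetSum _ fun i _ => hsq i).const_mul C), integral_const_mul,
            integral_finsetSum _ fun i _ => hsq i]
          simp
      _ ≤ δ + C * ∑ _i : Fin N, 1 / (n : ℝ) := by
          gcongr with i
          exact integral_empiricalFrequency_sub_sq_le hIm hindep hlaw hn i
      _ = δ + C * N / n := by
          simp only [Finset.sum_const, Finset.card_univ, Fintype.card_fin, nsmul_eq_mul]
          ring

theorem theoremt {X : Type*} [NormedAddCommGroup X] [NormedSpace ℝ X] [CompleteSpace X]
    [UniformConvexSpace X] {N : ℕ} (f : Fin N → X → ℝ)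
    (hU : ∀ i, IsUFunction (f i))
    (hG : ∀ i x, GateauxDifferentiableAt (f i) x)
    (hS : ∀ i, HasSmallDiameterProperty (f i)) :
    (∀ t ∈ stdSimplex ℝ (Fin N), ∃! x, IsMinOn (weightedSum f t) univ x) ∧
    ∃ ε : ℕ → ℝ, (∀ n, 0 < ε n) ∧ Tendsto ε atTop (𝓝 0) ∧
      ∀ t ∈ stdSimplex ℝ (Fin N),
      ∀ (Ω : Type*) [MeasurableSpace Ω] (μ : Measure Ω) [IsProbabilityMeasure μ]
        (F : ℕ → Ω → X → ℝ), IsRandomSample f t μ F →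
        ∀ n : ℕ, 1 ≤ n →
          (∀ᵐ ω ∂μ, ∃! x, IsMinOn (empiricalMean F n ω) univ x) ∧
          Integrable (fun ω => ‖argmin (empiricalMean F n ω) - argmin (weightedSum f t)‖) μ ∧
          ∫ ω, ‖argmin (empiricalMean F n ω) - argmin (weightedSum f t)‖ ∂μ ≤ ε n := by
  refine ⟨fun t ht => existsUnique_isMinOn_weightedSum hU ht, ?_⟩
  have hδ : ∀ m : ℕ, (0 : ℝ) < 1 / ((m : ℝ) + 1) := fun m => Nat.one_div_pos_of_nat
  choose C hC hmod using fun m : ℕ => exists_forall_norm_argmin_sub_le hU hG hS (hδ m)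
  -- The bounds `1 / (m + 1) + C m * N / n` are optimized over `m`; the summand `1 / (n + 1)` makes
  -- the result positive.
  set b : ℕ → ℕ → ℝ := fun n m => 1 / ((m : ℝ) + 1) + C m * N / n with hb
  have hb0 : ∀ n m, 0 ≤ b n m := fun n m =>
    add_nonneg (hδ m).le (div_nonneg (mul_nonneg (hC m) (Nat.cast_nonneg N)) (Nat.cast_nonneg n))
  have hbdd : ∀ n, BddBelow (range (b n)) := fun n => ⟨0, by rintro _ ⟨m, rfl⟩; exact hb0 n m⟩
  refine ⟨fun n => (⨅ m, b n m) + 1 / ((n : ℝ) + 1),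
    fun n => add_pos_of_nonneg_of_pos (Real.iInf_nonneg (hb0 n)) (hδ n), ?_, ?_⟩
  · have hinf : Tendsto (fun n => ⨅ m, b n m) atTop (𝓝 0) := by
      refine tendsto_order.2 ⟨fun a ha =>
        .of_forall fun n => ha.trans_le (Real.iInf_nonneg (hb0 n)), fun a ha => ?_⟩
      obtain ⟨m, hm⟩ := exists_nat_one_div_lt ha
      have hlim : Tendsto (fun n : ℕ => b n m) atTop (𝓝 (1 / ((m : ℝ) + 1) + 0)) :=
        tendsto_const_nhds.add (tendsto_const_div_atTop_nhds_zero_nat (C m * N))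
      filter_upwards [hlim.eventually_lt_const (by simpa using hm)] with n hn
      exact (ciInf_le (hbdd n) m).trans_lt hn
    simpa using hinf.add tendsto_one_div_add_atTop_nhds_zero_nat
  · intro t ht Ω _ μ _ F hF n hn
    obtain ⟨hmin, hint, hle⟩ := hF.integral_norm_argmin_sub_le hU ht hn
    exact ⟨hmin, hint, (le_ciInf fun m => hle _ _ (hC m) (hmod m)).trans
      (le_add_of_nonneg_right (hδ n).le)⟩
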